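/- Let $n,l\ge 0$ be integers, $S\in\mathbb{R}^{n\times l}$, $T\in\mathbb{R}^{l\times l}$, and let $\phi:\mathbb{R}^n\to\mathbb{R}^n$ be smooth ($C^\infty$) with $\phi(0)=0$ and $x^\top\phi(x)>0$ for all $x\neq 0$. Assume that $T+T^\top$ is negative semidefinite and that the pair $(S,T)$ is observable, i.e. the observability matrix obtained by stacking $S, ST,\dots,ST^{l-1}$ has rank $l$. Consider the system $$\dot x=-\phi(x)-Sz,\qquad \dot z=S^\top x+Tz,\qquad x\in\mathbb{R}^n,\ z\in\mathbb{R}^l .$$ Then the origin is asymptotically stable: for every $\varepsilon>0$ there is $\delta>0$ such that from every initial state of Euclidean norm less than $\delta$ there starts a solution on $[0,\infty)$ and every such solution stays in the open $\varepsilon$-ball around the origin for all $t\ge 0$; and there is $\delta_0>0$ such that every solution on $[0,\infty)$ with $\|(x(0),z(0))\|<\delta_0$ converges to the origin as $t\to\infty$. If, in addition, there are constants $\vartheta,\omega>0$ such that $\|\phi(x)-\phi(y)\|\le\vartheta\|x-y\|$ and $x^\top\phi(x)\ge\omega\,x^\top x$ for all $x,y\in\mathbb{R}^n$, then the origin is globally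 exponentially stable: there are constants $k,c>0$ such that from every initial state there starts a solution on $[0,\infty)$, and every solution on $[0,\infty)$ satisfies $$\|(x(t),z(t))\|\le k\,\|(x(0),z(0))\|\,e^{-ct}\qquad\text{for all } t\ge 0 .$$ -/

import Mathlib

open Set Filter Topology Matrix
open scoped ContDiff

namespace SaddleFlow

section Stability

variable {E : Type*} [NormedAddCommGroup E] [NormedSpace ℝ E]

/-- `γ` is a solution of the autonomous equation `ξ' = F ξ` on the time interval `[0, ∞)`
(one-sided derivative at `t = 0`). -/
def IsForwardSolution (F : E → E) (γ : ℝ → E) : Prop :=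
  ∀ t : ℝ, 0 ≤ t → HasDerivWithinAt γ (F (γ t)) (Ici 0) t

/-- The origin is (Lyapunov) stable for `ξ' = F ξ`: for every `ε > 0` there is `δ > 0` such that
from every initial state of norm less than `δ` a solution on `[0, ∞)` starts, and all such
solutions stay in the `ε`-ball. -/
def IsStable (F : E → E) : Prop :=
  ∀ ε : ℝ, 0 < ε → ∃ δ : ℝ, 0 < δ ∧ ∀ ξ₀ : E, ‖ξ₀‖ < δ →
    (∃ γ : ℝ → E, IsForwardSolution F γ ∧ γ 0 = ξ₀) ∧
    ∀ γ : ℝ → E, IsForwardSolution F γ → γ 0 = ξ₀ → ∀ t : ℝ, 0 ≤ t → ‖γ t‖ < ε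

/-- The origin is asymptotically stable for `ξ' = F ξ`: it is stable, and all solutions that
start close enough to the origin converge to it. -/
def IsAsymptoticallyStable (F : E → E) : Prop :=
  IsStable F ∧
    ∃ δ : ℝ, 0 < δ ∧ ∀ γ : ℝ → E, IsForwardSolution F γ → ‖γ 0‖ < δ →
      Tendsto γ atTop (𝓝 0)

/-- The origin is globally exponentially stable for `ξ' = F ξ`: from every initial state a
solution on `[0, ∞)` starts, and all solutions satisfy `‖γ t‖ ≤ k ‖γ 0‖ exp (-c t)` for `t ≥ 0`,
with positive constants `k`, `c` that do not depend on the solution. -/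
def IsGloballyExponentiallyStable (F : E → E) : Prop :=
  ∃ k c : ℝ, 0 < k ∧ 0 < c ∧ ∀ ξ₀ : E,
    (∃ γ : ℝ → E, IsForwardSolution F γ ∧ γ 0 = ξ₀) ∧
    ∀ γ : ℝ → E, IsForwardSolution F γ → γ 0 = ξ₀ →
      ∀ t : ℝ, 0 ≤ t → ‖γ t‖ ≤ k * ‖ξ₀‖ * Real.exp (-c * t)

end Stability

/-- The observability matrix of the pair `(S, T)`: the blocks `S, S T, …, S T ^ (l - 1)` stacked
on top of each other; row `(k, i)` is row `i` of `S T ^ k`. -/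
def observabilityMatrix {n l : ℕ} (S : Matrix (Fin n) (Fin l) ℝ) (T : Matrix (Fin l) (Fin l) ℝ) :
    Matrix (Fin l × Fin n) (Fin l) ℝ :=
  Matrix.of fun p j => (S * T ^ (p.1 : ℕ)) p.2 j

/-- The pair `(S, T)` (output matrix `S`, state matrix `T`) is observable. -/
def IsObservable {n l : ℕ} (S : Matrix (Fin n) (Fin l) ℝ) (T : Matrix (Fin l) (Fin l) ℝ) : Prop :=
  (observabilityMatrix S T).rank = l

/-- The state space `ℝⁿ × ℝˡ`, with the Euclidean norm `(‖x‖² + ‖z‖²)^(1/2)`. -/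
abbrev State (n l : ℕ) : Type :=
  WithLp 2 (EuclideanSpace ℝ (Fin n) × EuclideanSpace ℝ (Fin l))

/-- The right-hand side of the system `x' = -φ(x) - S z`, `z' = Sᵀ x + T z`. -/
noncomputable def vectorField {n l : ℕ}
    (φ : EuclideanSpace ℝ (Fin n) → EuclideanSpace ℝ (Fin n))
    (S : Matrix (Fin n) (Fin l) ℝ) (T : Matrix (Fin l) (Fin l) ℝ) (ξ : State n l) : State n l :=
  WithLp.toLp 2
    (-φ ξ.fst - WithLp.toLp 2 (S *ᵥ WithLp.ofLp ξ.snd),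
      WithLp.toLp 2 (Sᵀ *ᵥ WithLp.ofLp ξ.fst) + WithLp.toLp 2 (T *ᵥ WithLp.ofLp ξ.snd))

end SaddleFlow

/-! Along solutions the couplings through `S` and `Sᵀ` cancel in the derivative of `‖ξ‖ ^ 2` and `T`
contributes nothing positive, so this derivative is at most `-2 ⟪x, φ x⟫`. The norm is
nonincreasing, which gives stability and, after a cutoff, global existence.

This dissipation need not see `z`. Instead of an invariance principle, a correction `Q` of the
energy is built. Observability yields `P` such that `⟪z, P z⟫` has derivative at most `C ‖S z‖ ^ 2 -
κ ‖z‖ ^ 2` along `z' = T z` (`exists_lieForm_le_of_observable`), and adding `C ⟪x, S z⟫` cancels `C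
‖S z‖ ^ 2`, because `x'` contains `-S z`. Hence `Q' ≤ -κ ‖ξ‖ ^ 2 + K ‖x‖ ^ 2` with a smaller `κ`
(`IsObservable.exists_correction`).

A large multiple of the energy plus `Q` is comparable to `‖ξ‖ ^ 2`. Under the global bounds the
energy absorbs `K ‖x‖ ^ 2` and the decay is exponential. In general `K ‖x‖ ^ 2` is a forcing term
that vanishes as `t → ∞`, by the Barbalat argument `eventually_lt_of_dissipation`. -/

namespace SaddleFlow

/-! ### Global integral curves of bounded Lipschitz fields. -/

section Existence

open Metric NNReal

variable {E : Type*} [NormedAddCommGroup E] [NormedSpace ℝ E]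

lemma exists_hasDerivAt_Ioo_of_lipschitz_of_bounded [CompleteSpace E] {F : E → E} {K L : ℝ≥0}
    (hK : LipschitzWith K F) (hL : ∀ x, ‖F x‖ ≤ L) (x₀ : E) {b : ℝ} (hb : 0 < b) :
    ∃ γ : ℝ → E, γ 0 = x₀ ∧ ∀ t ∈ Ioo (-b) b, HasDerivAt γ (F (γ t)) t := by
  have h0 : (0 : ℝ) ∈ Icc (-b) b := ⟨by linarith, hb.le⟩
  -- Speed at most `L` confines the curve to radius `L * b` during time `b`, so `b` can be
  -- arbitrary.
  have hP : IsPicardLindelof (fun _ : ℝ => F) (⟨0, h0⟩ : Icc (-b) b) x₀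
      (L * ⟨b, hb.le⟩) 0 L K :=
    .of_time_independent (fun x _ => hL x) hK.lipschitzOnWith (by simp; rfl)
  obtain ⟨γ, hγ0, hγ⟩ := hP.exists_eq_forall_mem_Icc_hasDerivWithinAt₀
  exact ⟨γ, hγ0, fun t ht =>
    (hγ t (Ioo_subset_Icc_self ht)).hasDerivAt (Icc_mem_nhds ht.1 ht.2)⟩

/-- A bounded, globally Lipschitz vector field has a global integral curve through each point. -/
lemma exists_hasDerivAt_of_lipschitz_of_bounded [CompleteSpace E] {F : E → E} {K L : ℝ≥0}
    (hK : LipschitzWith K F) (hL : ∀ x, ‖F x‖ ≤ L) (x₀ : E) :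
    ∃ γ : ℝ → E, γ 0 = x₀ ∧ ∀ t, HasDerivAt γ (F (γ t)) t := by
  choose γ hγ0 hγ using fun N : ℕ =>
    exists_hasDerivAt_Ioo_of_lipschitz_of_bounded hK hL x₀ (b := N + 1) (by positivity)
  -- By uniqueness the curves on nested intervals agree, so they glue, using index `⌈|t|⌉₊` at time
  -- `t`.
  have hEq : ∀ {M N : ℕ}, M ≤ N → EqOn (γ M) (γ N) (Ioo (-(M + 1 : ℝ)) (M + 1)) := by
    intro M N hMN
    have hMN' : (M : ℝ) ≤ N := by exact_mod_cast hMN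
    refine ODE_solution_unique_of_mem_Ioo (v := fun _ => F) (s := fun _ => univ) (K := K)
      (t₀ := 0) (fun _ _ => hK.lipschitzOnWith) ⟨?_, ?_⟩ (fun t ht => ⟨hγ M t ht, mem_univ _⟩)
      (fun t ht => ⟨hγ N t ⟨?_, ?_⟩, mem_univ _⟩) (by rw [hγ0, hγ0])
    · have : (0 : ℝ) ≤ M := by positivity
      linarith
    · positivity
    · linarith [ht.1]
    · linarith [ht.2]
  have hmem : ∀ t : ℝ, t ∈ Ioo (-((⌈|t|⌉₊ : ℝ) + 1)) (⌈|t|⌉₊ + 1) := by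
    intro t
    have h := Nat.le_ceil |t|
    constructor
    · linarith [neg_abs_le t]
    · linarith [le_abs_self t]
  have hloc : ∀ (N : ℕ) (t : ℝ), t ∈ Ioo (-(N + 1 : ℝ)) (N + 1) →
      γ ⌈|t|⌉₊ t = γ N t := by
    intro N t ht
    rcases le_total ⌈|t|⌉₊ N with h | h
    · exact hEq h (hmem t)
    · exact (hEq h ht).symm
  refine ⟨fun t => γ ⌈|t|⌉₊ t, by simp [hγ0], fun t => ?_⟩
  refine (hγ _ t (hmem t)).congr_of_eventuallyEq ?_
  filter_upwards [Ioo_mem_nhds (hmem t).1 (hmem t).2] with s hs using hloc _ s hs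

end Existence

/-! ### Monotone norm and existence for dissipative fields. -/

section Dissipative

variable {E : Type*} [NormedAddCommGroup E] [InnerProductSpace ℝ E]

/-- A function with nonpositive derivative on `[0, ∞)` is nonincreasing there. -/
lemma antitoneOn_Ici_of_hasDerivWithinAt_nonpos {f f' : ℝ → ℝ} {a : ℝ} (ha : 0 ≤ a)
    (hf : ∀ t, 0 ≤ t → HasDerivWithinAt f (f' t) (Ici 0) t)
    (hf' : ∀ t, a ≤ t → f' t ≤ 0) : AntitoneOn f (Ici a) := by
  have hd : ∀ t ∈ interior (Ici a), HasDerivAt f (f' t) t := by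
    intro t ht
    rw [interior_Ici] at ht
    have ht0 : 0 < t := ha.trans_lt ht
    exact (hf t ht0.le).hasDerivAt (Ici_mem_nhds ht0)
  refine antitoneOn_of_deriv_nonpos (convex_Ici a) (fun t ht => ?_)
    (fun t ht => (hd t ht).differentiableAt.differentiableWithinAt) (fun t ht => ?_)
  · exact (hf t (ha.trans ht)).continuousWithinAt.mono (Ici_subset_Ici.2 ha)
  · rw [(hd t ht).deriv]
    rw [interior_Ici] at ht
    exact hf' t (le_of_lt ht)

lemma IsForwardSolution.hasDerivWithinAt_norm_sq {F : E → E} {γ : ℝ → E}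
    (hγ : IsForwardSolution F γ) {t : ℝ} (ht : 0 ≤ t) :
    HasDerivWithinAt (fun t => ‖γ t‖ ^ 2) (2 * inner ℝ (γ t) (F (γ t))) (Ici 0) t :=
  (hγ t ht).norm_sq

lemma IsForwardSolution.antitoneOn_norm {F : E → E} (hF : ∀ ξ, inner ℝ ξ (F ξ) ≤ 0)
    {γ : ℝ → E} (hγ : IsForwardSolution F γ) : AntitoneOn (fun t => ‖γ t‖) (Ici 0) := by
  have h := antitoneOn_Ici_of_hasDerivWithinAt_nonpos le_rfl
    (fun t ht => hγ.hasDerivWithinAt_norm_sq ht)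
    (fun t _ => by linarith [hF (γ t)])
  intro s hs t ht hst
  exact (pow_le_pow_iff_left₀ (norm_nonneg _) (norm_nonneg _) two_ne_zero).1 (h hs ht hst)

lemma IsForwardSolution.norm_le {F : E → E} (hF : ∀ ξ, inner ℝ ξ (F ξ) ≤ 0)
    {γ : ℝ → E} (hγ : IsForwardSolution F γ) {t : ℝ} (ht : 0 ≤ t) : ‖γ t‖ ≤ ‖γ 0‖ :=
  hγ.antitoneOn_norm hF self_mem_Ici ht ht

/-- A dissipative `C¹` vector field has a solution on `[0, ∞)` from each initial state. -/
lemma exists_isForwardSolution_of_dissipative [FiniteDimensional ℝ E] {F : E → E}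
    (hF : ∀ ξ, inner ℝ ξ (F ξ) ≤ 0) (hF1 : ContDiff ℝ 1 F) (ξ₀ : E) :
    ∃ γ : ℝ → E, IsForwardSolution F γ ∧ γ 0 = ξ₀ := by
  -- The cutoff field is still dissipative, so its solution never leaves the ball of radius `‖ξ₀‖`,
  -- where `χ = 1` and it solves the original equation.
  let χ : ContDiffBump (0 : E) := ⟨‖ξ₀‖ + 1, ‖ξ₀‖ + 2, by positivity, by linarith⟩
  let G : E → E := fun ξ => χ ξ • F ξ
  have hG1 : ContDiff ℝ 1 G := χ.contDiff.smul hF1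
  have hGs : HasCompactSupport G := χ.hasCompactSupport.smul_right
  have hG : ∀ ξ, inner ℝ ξ (G ξ) ≤ 0 := fun ξ => by
    simp only [G, inner_smul_right]
    exact mul_nonpos_of_nonneg_of_nonpos χ.nonneg (hF ξ)
  obtain ⟨K, hK⟩ := hG1.lipschitzWith_of_hasCompactSupport hGs one_ne_zero
  obtain ⟨L, hL⟩ := hGs.exists_bound_of_continuous hG1.continuous
  obtain ⟨γ, hγ0, hγ⟩ := exists_hasDerivAt_of_lipschitz_of_bounded hK (L := L.toNNReal)
    (fun x => (hL x).trans (Real.le_coe_toNNReal L)) ξ₀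
  have hsol : IsForwardSolution G γ := fun t _ => (hγ t).hasDerivWithinAt
  refine ⟨γ, fun t ht => ?_, hγ0⟩
  have hle := hsol.norm_le hG ht
  have h1 : χ (γ t) = 1 := χ.one_of_mem_closedBall (by
    rw [mem_closedBall_zero_iff]
    change ‖γ t‖ ≤ ‖ξ₀‖ + 1
    rw [hγ0] at hle
    linarith)
  have := hsol t ht
  simpa only [G, h1, one_smul] using this

end Dissipative

/-! ### Quadratic forms obtained from observability. -/

section LyapunovForm

variable {H G : Type*} [NormedAddCommGroup H] [InnerProductSpace ℝ H]
  [NormedAddCommGroup G] [InnerProductSpace ℝ G]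

/-- The derivative of the quadratic form `u ↦ ⟪u, P u⟫` along `u' = T u`. -/
noncomputable def lieForm (T P : G →L[ℝ] G) (u : G) : ℝ :=
  inner ℝ (T u) (P u) + inner ℝ u (P (T u))

lemma lieForm_add (T P Q : G →L[ℝ] G) (u : G) :
    lieForm T (P + Q) u = lieForm T P u + lieForm T Q u := by
  simp only [lieForm, _root_.add_apply, inner_add_right]
  ring

lemma lieForm_smul (T P : G →L[ℝ] G) (c : ℝ) (u : G) :
    lieForm T (c • P) u = c * lieForm T P u := by
  simp only [lieForm, _root_.smul_apply, inner_smul_right]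
  ring

/-- A Lyapunov-type quadratic form detecting the `m`-th observation `S (T ^ m u)` from `S u`. -/
lemma exists_lieForm_le_output [CompleteSpace H] [CompleteSpace G] (S : G →L[ℝ] H)
    (T : G →L[ℝ] G) (m : ℕ) : ∀ η : ℝ, 0 < η → ∃ (C : ℝ) (P : G →L[ℝ] G), ∀ u,
      lieForm T P u ≤ C * ‖S u‖ ^ 2 - ‖S ((T ^ m) u)‖ ^ 2 + η * ‖u‖ ^ 2 := by
  induction m with
  | zero =>
    refine fun η hη => ⟨1, 0, fun u => ?_⟩
    have : 0 ≤ η * ‖u‖ ^ 2 := by positivity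
    simp [lieForm]
    exact this
  | succ m ih =>
    intro η hη
    obtain ⟨A, hA⟩ : ∃ A : G →L[ℝ] H, A = S ∘L T ^ m := ⟨_, rfl⟩
    obtain ⟨B, hB⟩ : ∃ B : G →L[ℝ] H, B = S ∘L T ^ (m + 1) := ⟨_, rfl⟩
    have hAT : ∀ u, A (T u) = B u := fun u => by simp [hA, hB, pow_succ]
    set N : ℝ := ‖B ∘L T‖ with hN
    have hBT : ∀ u, ‖B (T u)‖ ≤ N * ‖u‖ := fun u => (B ∘L T).le_opNorm u
    -- Young's inequality needs only `N ^ 2 / (2 * η)`; the `+ 1` keeps `K` positive when `N = 0`.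
    set K : ℝ := (N ^ 2 + 1) / (2 * η) with hK
    have hK0 : 0 < K := by positivity
    obtain ⟨C, P, hP⟩ := ih (η / (2 * K)) (by positivity)
    -- The derivative of `⟪A u, B u⟫` is `‖B u‖ ^ 2 + ⟪A u, B (T u)⟫`; subtracting it produces `-‖B
    -- u‖ ^ 2`. The cross term costs `K ‖A u‖ ^ 2`, paid for by `K` times the induction hypothesis,
    -- whose error was taken as `η / (2 * K)` for this reason.
    refine ⟨K * C, K • P + (-1 : ℝ) • (A.adjoint ∘L B), fun u => ?_⟩
    have h1 : lieForm T (A.adjoint ∘L B) u = ‖B u‖ ^ 2 + inner ℝ (A u) (B (T u)) := by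
      simp only [lieForm, ContinuousLinearMap.comp_apply, ContinuousLinearMap.adjoint_inner_right,
        hAT, real_inner_self_eq_norm_sq]
    have h2 : -inner ℝ (A u) (B (T u)) ≤ ‖A u‖ * (N * ‖u‖) := by
      have := abs_real_inner_le_norm (A u) (B (T u))
      have h3 := mul_le_mul_of_nonneg_left (hBT u) (norm_nonneg (A u))
      linarith [neg_abs_le (inner ℝ (A u) (B (T u)))]
    have h4 : ‖A u‖ * (N * ‖u‖) ≤ K * ‖A u‖ ^ 2 + η / 2 * ‖u‖ ^ 2 := by
      have h5 : K * ‖A u‖ ^ 2 + η / 2 * ‖u‖ ^ 2 - ‖A u‖ * (N * ‖u‖)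
          = ((N * ‖A u‖ - η * ‖u‖) ^ 2 + ‖A u‖ ^ 2) / (2 * η) := by
        rw [hK]
        field_simp
        ring
      have h6 : 0 ≤ ((N * ‖A u‖ - η * ‖u‖) ^ 2 + ‖A u‖ ^ 2) / (2 * η) := by positivity
      linarith
    have h7 : K * lieForm T P u ≤ K * C * ‖S u‖ ^ 2 - K * ‖A u‖ ^ 2 + η / 2 * ‖u‖ ^ 2 := by
      have := mul_le_mul_of_nonneg_left (hP u) hK0.le
      have h8 : K * (η / (2 * K) * ‖u‖ ^ 2) = η / 2 * ‖u‖ ^ 2 := by field_simp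
      have h9 : S ((T ^ m) u) = A u := by simp [hA]
      rw [h9] at this
      linarith
    have h10 : S ((T ^ (m + 1)) u) = B u := by simp [hB]
    rw [lieForm_add, lieForm_smul, lieForm_smul, h1, h10]
    linarith

lemma exists_lieForm_le_sum_output [CompleteSpace H] [CompleteSpace G] (S : G →L[ℝ] H)
    (T : G →L[ℝ] G) (l : ℕ) : ∀ η : ℝ, 0 < η → ∃ (C : ℝ) (P : G →L[ℝ] G), ∀ u,
      lieForm T P u ≤ C * ‖S u‖ ^ 2 - ∑ m ∈ Finset.range l, ‖S ((T ^ m) u)‖ ^ 2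
        + η * ‖u‖ ^ 2 := by
  induction l with
  | zero =>
    refine fun η hη => ⟨0, 0, fun u => ?_⟩
    have : 0 ≤ η * ‖u‖ ^ 2 := by positivity
    simp [lieForm]
    exact this
  | succ l ih =>
    intro η hη
    obtain ⟨C, P, hP⟩ := ih (η / 2) (by positivity)
    obtain ⟨C', P', hP'⟩ := exists_lieForm_le_output S T l (η / 2) (by positivity)
    refine ⟨C + C', P + P', fun u => ?_⟩
    rw [lieForm_add, Finset.sum_range_succ]
    linarith [hP u, hP' u]

/-- If the outputs `S (T ^ m u)`, `m < l`, determine `u`, then some quadratic form has a derivative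
along `u' = T u` that is negative definite up to a multiple of `‖S u‖ ^ 2`. -/
lemma exists_lieForm_le_of_observable [FiniteDimensional ℝ H] [FiniteDimensional ℝ G]
    (S : G →L[ℝ] H) (T : G →L[ℝ] G) (l : ℕ)
    (hobs : ∀ u, (∀ m < l, S ((T ^ m) u) = 0) → u = 0) :
    ∃ (C κ : ℝ) (P : G →L[ℝ] G), 0 ≤ C ∧ 0 < κ ∧
      ∀ u, lieForm T P u ≤ C * ‖S u‖ ^ 2 - κ * ‖u‖ ^ 2 := by
  have := FiniteDimensional.complete ℝ H
  have := FiniteDimensional.complete ℝ G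
  let O : G →L[ℝ] (Fin l → H) := ContinuousLinearMap.pi fun m => S ∘L T ^ (m : ℕ)
  have hker : LinearMap.ker (O : G →ₗ[ℝ] (Fin l → H)) = ⊥ := by
    rw [LinearMap.ker_eq_bot']
    intro u hu
    exact hobs u fun m hm => congrFun hu ⟨m, hm⟩
  obtain ⟨K, hK0, hK⟩ := LinearMap.exists_antilipschitzWith _ hker
  have hKr : (0 : ℝ) < K := hK0
  have hsum : ∀ u, ‖u‖ ^ 2 ≤ (K : ℝ) ^ 2 * ∑ m ∈ Finset.range l, ‖S ((T ^ m) u)‖ ^ 2 := by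
    intro u
    have h1 : ‖u‖ ≤ K * ‖O u‖ := by
      simpa using hK.le_mul_dist u 0
    have h2 : ‖O u‖ ≤ √(∑ m ∈ Finset.range l, ‖S ((T ^ m) u)‖ ^ 2) := by
      refine (pi_norm_le_iff_of_nonneg (Real.sqrt_nonneg _)).2 fun m => Real.le_sqrt_of_sq_le ?_
      exact Finset.single_le_sum (f := fun m => ‖S ((T ^ m) u)‖ ^ 2)
        (fun _ _ => by positivity) (Finset.mem_range.2 m.2)
    have h3 : ‖u‖ ≤ K * √(∑ m ∈ Finset.range l, ‖S ((T ^ m) u)‖ ^ 2) :=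
      h1.trans (mul_le_mul_of_nonneg_left h2 hKr.le)
    calc ‖u‖ ^ 2 ≤ (K * √(∑ m ∈ Finset.range l, ‖S ((T ^ m) u)‖ ^ 2)) ^ 2 := by gcongr
      _ = _ := by rw [mul_pow, Real.sq_sqrt (Finset.sum_nonneg fun _ _ => by positivity)]
  -- The outputs control `‖u‖ ^ 2 / K ^ 2`; the error is allowed half of that.
  obtain ⟨C, P, hP⟩ := exists_lieForm_le_sum_output S T l (1 / (2 * (K : ℝ) ^ 2)) (by positivity)
  refine ⟨|C|, 1 / (2 * (K : ℝ) ^ 2), P, abs_nonneg C, by positivity, fun u => ?_⟩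
  have h1 : 1 / (K : ℝ) ^ 2 * ‖u‖ ^ 2 ≤ ∑ m ∈ Finset.range l, ‖S ((T ^ m) u)‖ ^ 2 := by
    rw [div_mul_eq_mul_div, one_mul, div_le_iff₀ (by positivity)]
    linarith [hsum u]
  have h2 : 1 / (K : ℝ) ^ 2 * ‖u‖ ^ 2 = 2 * (1 / (2 * (K : ℝ) ^ 2) * ‖u‖ ^ 2) := by field_simp
  have h3 : C * ‖S u‖ ^ 2 ≤ |C| * ‖S u‖ ^ 2 := by
    gcongr
    exact le_abs_self C
  linarith [hP u]

end LyapunovForm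

/-! ### Matrices as Euclidean operators. -/

section Matrices

variable {n l : ℕ}

/-- The Euclidean operator of a matrix. -/
noncomputable def euclideanOp {m k : ℕ} (A : Matrix (Fin m) (Fin k) ℝ) :
    EuclideanSpace ℝ (Fin k) →L[ℝ] EuclideanSpace ℝ (Fin m) :=
  LinearMap.toContinuousLinearMap (Matrix.toLpLin 2 2 A)

lemma euclideanOp_apply {m k : ℕ} (A : Matrix (Fin m) (Fin k) ℝ) (x : EuclideanSpace ℝ (Fin k)) :
    euclideanOp A x = WithLp.toLp 2 (A *ᵥ WithLp.ofLp x) := rfl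

lemma inner_euclideanOp_transpose {m k : ℕ} (A : Matrix (Fin m) (Fin k) ℝ)
    (x : EuclideanSpace ℝ (Fin m)) (z : EuclideanSpace ℝ (Fin k)) :
    inner ℝ z (euclideanOp Aᵀ x) = inner ℝ x (euclideanOp A z) := by
  simp only [euclideanOp_apply, EuclideanSpace.inner_eq_star_dotProduct, star_trivial]
  rw [Matrix.mulVec_transpose, ← Matrix.dotProduct_mulVec, dotProduct_comm]

lemma euclideanOp_pow_apply {k : ℕ} (A : Matrix (Fin k) (Fin k) ℝ) (p : ℕ)
    (x : EuclideanSpace ℝ (Fin k)) :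
    (euclideanOp A ^ p) x = WithLp.toLp 2 ((A ^ p) *ᵥ WithLp.ofLp x) := by
  induction p with
  | zero => simp
  | succ p ih =>
    rw [pow_succ', pow_succ', mul_apply_eq_comp, ih, euclideanOp_apply,
      Matrix.mulVec_mulVec]

lemma inner_euclideanOp_nonpos {T : Matrix (Fin l) (Fin l) ℝ} (hT : (-(T + Tᵀ)).PosSemidef)
    (z : EuclideanSpace ℝ (Fin l)) : inner ℝ z (euclideanOp T z) ≤ 0 := by
  have h := hT.dotProduct_mulVec_nonneg (WithLp.ofLp z)
  have h1 := inner_euclideanOp_transpose T z z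
  have h2 : star (WithLp.ofLp z) ⬝ᵥ (-(T + Tᵀ)) *ᵥ (WithLp.ofLp z)
      = -(inner ℝ z (euclideanOp T z) + inner ℝ z (euclideanOp Tᵀ z)) := by
    simp only [euclideanOp_apply, EuclideanSpace.inner_eq_star_dotProduct, star_trivial]
    rw [Matrix.neg_mulVec, Matrix.add_mulVec, dotProduct_neg, dotProduct_add,
      dotProduct_comm (T *ᵥ _), dotProduct_comm (Tᵀ *ᵥ _)]
  rw [h2, h1] at h
  linarith

lemma IsObservable.eq_zero {S : Matrix (Fin n) (Fin l) ℝ} {T : Matrix (Fin l) (Fin l) ℝ}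
    (h : IsObservable S T) (z : EuclideanSpace ℝ (Fin l))
    (hz : ∀ m < l, euclideanOp S ((euclideanOp T ^ m) z) = 0) : z = 0 := by
  have hrank : (observabilityMatrix S T).rank = Fintype.card (Fin l) := by
    rw [Fintype.card_fin]
    exact h
  have hinj : Function.Injective (observabilityMatrix S T).mulVec := by
    rw [Matrix.mulVec_injective_iff, linearIndependent_iff_card_eq_finrank_span, ← hrank,
      Matrix.rank_eq_finrank_span_cols, Set.finrank]
  have h0 : observabilityMatrix S T *ᵥ WithLp.ofLp z = 0 := by
    ext ⟨m, i⟩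
    have := hz m m.2
    rw [euclideanOp_pow_apply, euclideanOp_apply, Matrix.mulVec_mulVec] at this
    exact congrFun (congrArg WithLp.ofLp this) i
  have h1 : WithLp.ofLp z = 0 := hinj (by rw [h0, Matrix.mulVec_zero])
  ext i
  exact congrFun h1 i

end Matrices

/-! ### Scalar differential inequalities. -/

section Scalar

/-- Comparison lemma for `f' ≤ -c (f - ε)` on `[a, ∞)`. -/
lemma le_add_exp_of_deriv_le {f f' : ℝ → ℝ} {a c ε : ℝ} (ha : 0 ≤ a)
    (hf : ∀ t, 0 ≤ t → HasDerivWithinAt f (f' t) (Ici 0) t)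
    (hf' : ∀ t, a ≤ t → f' t ≤ -c * (f t - ε)) {t : ℝ} (ht : a ≤ t) :
    f t ≤ ε + (f a - ε) * Real.exp (-c * (t - a)) := by
  -- Integrating factor: `(f - ε) * exp (c * (t - a))` is nonincreasing.
  have hd : ∀ t, 0 ≤ t → HasDerivWithinAt (fun t => (f t - ε) * Real.exp (c * (t - a)))
      (f' t * Real.exp (c * (t - a)) + (f t - ε) * (Real.exp (c * (t - a)) * (c * 1)))
      (Ici 0) t := fun t ht =>
    ((hf t ht).sub_const ε).mul
      ((((hasDerivAt_id t).sub_const a).const_mul c).exp.hasDerivWithinAt)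
  have h := antitoneOn_Ici_of_hasDerivWithinAt_nonpos ha hd (fun t ht => by
    have := mul_le_mul_of_nonneg_right (hf' t ht) (Real.exp_pos (c * (t - a))).le
    linarith) self_mem_Ici ht ht
  simp only [sub_self, mul_zero, Real.exp_zero, mul_one] at h
  have h1 := mul_le_mul_of_nonneg_right h (Real.exp_pos (-c * (t - a))).le
  rw [mul_assoc, ← Real.exp_add, show c * (t - a) + -c * (t - a) = 0 by ring, Real.exp_zero] at h1
  linarith

/-- If `f' ≤ -c f + g` with `c > 0` and `g → 0`, then `f` is eventually below each `ε > 0`. -/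
lemma eventually_lt_of_deriv_le_add {f f' g : ℝ → ℝ} {c : ℝ} (hc : 0 < c)
    (hf : ∀ t, 0 ≤ t → HasDerivWithinAt f (f' t) (Ici 0) t)
    (hf' : ∀ t, 0 ≤ t → f' t ≤ -c * f t + g t) (hg : Tendsto g atTop (𝓝 0))
    {ε : ℝ} (hε : 0 < ε) : ∀ᶠ t in atTop, f t < ε := by
  obtain ⟨a, ha⟩ := eventually_atTop.1 ((hg.eventually_lt_const
    (show 0 < c * (ε / 2) by positivity)).and (eventually_ge_atTop 0))
  have ha0 : 0 ≤ a := (ha a le_rfl).2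
  have hlim : Tendsto (fun t => ε / 2 + (f a - ε / 2) * Real.exp (-c * (t - a))) atTop
      (𝓝 (ε / 2 + (f a - ε / 2) * 0)) := by
    refine tendsto_const_nhds.add (tendsto_const_nhds.mul (Real.tendsto_exp_atBot.comp ?_))
    exact (tendsto_atTop_add_const_right _ (-a) tendsto_id).const_mul_atTop_of_neg
      (neg_lt_zero.2 hc)
  have hlim' := hlim.eventually_lt_const (show ε / 2 + (f a - ε / 2) * 0 < ε by linarith)
  filter_upwards [hlim', eventually_ge_atTop a] with t ht hat
  refine (le_add_exp_of_deriv_le ha0 hf (fun s hs => ?_) hat).trans_lt ht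
  have h1 := hf' s (ha0.trans hs)
  have h2 := (ha s hs).1
  linarith

/-- A Barbalat-type lemma: if `v ≥ 0` is nonincreasing, and decreases at a definite rate whenever
the Lipschitz function `g` is not small, then `g` is eventually small. -/
lemma eventually_lt_of_dissipation {v v' g : ℝ → ℝ} {B : ℝ}
    (hv0 : ∀ t, 0 ≤ t → 0 ≤ v t)
    (hv : ∀ t, 0 ≤ t → HasDerivWithinAt v (v' t) (Ici 0) t)
    (hv' : ∀ t, 0 ≤ t → v' t ≤ 0) (hB : 0 ≤ B)
    (hg : ∀ s t, 0 ≤ s → s ≤ t → g s ≤ g t + B * (t - s))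
    (hdiss : ∀ ε, 0 < ε → ∃ m, 0 < m ∧ ∀ t, 0 ≤ t → ε ≤ g t → v' t ≤ -m)
    {ε : ℝ} (hε : 0 < ε) : ∀ᶠ t in atTop, g t < ε := by
  have hanti := antitoneOn_Ici_of_hasDerivWithinAt_nonpos le_rfl hv hv'
  obtain ⟨m, hm, hmv⟩ := hdiss (ε / 2) (by positivity)
  -- If `g t ≥ ε`, then `g ≥ ε / 2` on `[t, t + h]`, so `v` drops by at least `m * h` there. Since
  -- `v` converges, this is impossible for large `t`.
  obtain ⟨h, hh⟩ : ∃ h : ℝ, h = ε / (2 * (B + 1)) := ⟨_, rfl⟩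
  have hh0 : 0 < h := by rw [hh]; positivity
  have hBh : B * h ≤ ε / 2 := by
    have : (B + 1) * h = ε / 2 := by rw [hh]; field_simp
    linarith
  obtain ⟨L, hL⟩ : ∃ L, Tendsto v atTop (𝓝 L) := by
    have ha : Antitone fun t => v (max 0 t) := fun s t hst =>
      hanti (mem_Ici.2 (le_max_left _ _)) (mem_Ici.2 (le_max_left _ _)) (max_le_max le_rfl hst)
    have hbdd : BddBelow (range fun t => v (max 0 t)) :=
      ⟨0, by rintro _ ⟨t, rfl⟩; exact hv0 _ (le_max_left _ _)⟩
    refine ⟨_, (tendsto_atTop_ciInf ha hbdd).congr' ?_⟩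
    filter_upwards [eventually_ge_atTop 0] with t ht
    rw [max_eq_right ht]
  have hdiff : Tendsto (fun t => v t - v (t + h)) atTop (𝓝 (L - L)) :=
    hL.sub (hL.comp (tendsto_atTop_add_const_right _ h tendsto_id))
  have hev := hdiff.eventually_lt_const (show L - L < m * h by rw [sub_self]; positivity)
  filter_upwards [hev, eventually_ge_atTop 0] with t ht ht0
  by_contra! hgt
  have hder : ∀ s ∈ interior (Icc t (t + h)), HasDerivAt v (v' s) s := fun s hs => by
    rw [interior_Icc] at hs
    have : 0 < s := ht0.trans_lt hs.1
    exact (hv s this.le).hasDerivAt (Ici_mem_nhds this)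
  have hle := (convex_Icc t (t + h)).image_sub_le_mul_sub_of_deriv_le (f := v) (C := -m)
    (fun s hs => (hv s (ht0.trans hs.1)).continuousWithinAt.mono
      (Icc_subset_Ici_self.trans (Ici_subset_Ici.2 ht0)))
    (fun s hs => (hder s hs).differentiableAt.differentiableWithinAt)
    (fun s hs => by
      rw [(hder s hs).deriv]
      have hs' := interior_subset hs
      refine hmv s (ht0.trans hs'.1) ?_
      have h1 := hg t s ht0 hs'.1
      have h2 : B * (s - t) ≤ B * h := by
        gcongr
        linarith [hs'.2]
      linarith)
    t ⟨le_rfl, by linarith⟩ (t + h) ⟨by linarith, le_rfl⟩ (by linarith)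
  linarith

end Scalar

/-! ### Energy identity and the corrected energy. -/

section System

variable {n l : ℕ} {φ : EuclideanSpace ℝ (Fin n) → EuclideanSpace ℝ (Fin n)}
  {S : Matrix (Fin n) (Fin l) ℝ} {T : Matrix (Fin l) (Fin l) ℝ}

lemma norm_sq_state (ξ : State n l) : ‖ξ‖ ^ 2 = ‖ξ.fst‖ ^ 2 + ‖ξ.snd‖ ^ 2 :=
  WithLp.prod_norm_sq_eq_of_L2 _

lemma vectorField_fst (ξ : State n l) :
    (vectorField φ S T ξ).fst = -φ ξ.fst - euclideanOp S ξ.snd := rfl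

lemma vectorField_snd (ξ : State n l) :
    (vectorField φ S T ξ).snd = euclideanOp Sᵀ ξ.fst + euclideanOp T ξ.snd := rfl

lemma inner_vectorField (ξ : State n l) : inner ℝ ξ (vectorField φ S T ξ)
    = -inner ℝ ξ.fst (φ ξ.fst) + inner ℝ ξ.snd (euclideanOp T ξ.snd) := by
  change inner ℝ ξ.fst (vectorField φ S T ξ).fst + inner ℝ ξ.snd (vectorField φ S T ξ).snd = _
  rw [vectorField_fst, vectorField_snd, inner_sub_right, inner_add_right, inner_neg_right,
    inner_euclideanOp_transpose]
  ring

lemma inner_vectorField_le (hT : (-(T + Tᵀ)).PosSemidef) (ξ : State n l) :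
    inner ℝ ξ (vectorField φ S T ξ) ≤ -inner ℝ ξ.fst (φ ξ.fst) := by
  rw [inner_vectorField]
  linarith [inner_euclideanOp_nonpos hT ξ.snd]

lemma contDiff_vectorField (hφ : ContDiff ℝ 1 φ) : ContDiff ℝ 1 (vectorField φ S T) := by
  have h1 : ContDiff ℝ 1 (fun ξ : State n l => ξ.fst) :=
    (WithLp.fstL 2 ℝ (EuclideanSpace ℝ (Fin n)) (EuclideanSpace ℝ (Fin l))).contDiff
  have h2 : ContDiff ℝ 1 (fun ξ : State n l => ξ.snd) :=
    (WithLp.sndL 2 ℝ (EuclideanSpace ℝ (Fin n)) (EuclideanSpace ℝ (Fin l))).contDiff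
  have h3 : ContDiff ℝ 1 (fun ξ : State n l => (-φ ξ.fst - euclideanOp S ξ.snd,
      euclideanOp Sᵀ ξ.fst + euclideanOp T ξ.snd)) :=
    ((hφ.comp h1).neg.sub ((euclideanOp S).contDiff.comp h2)).prodMk
      (((euclideanOp Sᵀ).contDiff.comp h1).add ((euclideanOp T).contDiff.comp h2))
  exact (WithLp.prodContinuousLinearEquiv 2 ℝ (EuclideanSpace ℝ (Fin n))
    (EuclideanSpace ℝ (Fin l))).symm.contDiff.comp h3

lemma IsForwardSolution.hasDerivWithinAt_fst {F : State n l → State n l} {γ : ℝ → State n l}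
    (hγ : IsForwardSolution F γ) {t : ℝ} (ht : 0 ≤ t) :
    HasDerivWithinAt (fun t => (γ t).fst) (F (γ t)).fst (Ici 0) t :=
  (WithLp.fstL 2 ℝ (EuclideanSpace ℝ (Fin n))
    (EuclideanSpace ℝ (Fin l))).hasFDerivAt.comp_hasDerivWithinAt t (hγ t ht)

lemma IsForwardSolution.hasDerivWithinAt_snd {F : State n l → State n l} {γ : ℝ → State n l}
    (hγ : IsForwardSolution F γ) {t : ℝ} (ht : 0 ≤ t) :
    HasDerivWithinAt (fun t => (γ t).snd) (F (γ t)).snd (Ici 0) t :=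
  (WithLp.sndL 2 ℝ (EuclideanSpace ℝ (Fin n))
    (EuclideanSpace ℝ (Fin l))).hasFDerivAt.comp_hasDerivWithinAt t (hγ t ht)

/-- For an observable pair, a correction `Q` of the energy whose derivative along solutions is
negative definite up to a multiple of `‖x‖ ^ 2`, wherever `‖φ x‖ ≤ θ ‖x‖`. -/
lemma IsObservable.exists_correction (hST : IsObservable S T) {θ : ℝ} (hθ : 0 ≤ θ) :
    ∃ (Q : State n l → ℝ) (D κ K : ℝ), 0 ≤ D ∧ 0 < κ ∧ 0 ≤ K ∧ (∀ ξ, |Q ξ| ≤ D * ‖ξ‖ ^ 2) ∧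
      ∀ γ : ℝ → State n l, IsForwardSolution (vectorField φ S T) γ → ∀ t, 0 ≤ t →
        ‖φ (γ t).fst‖ ≤ θ * ‖(γ t).fst‖ → ∃ d, HasDerivWithinAt (fun t => Q (γ t)) d (Ici 0) t ∧
          d ≤ -κ * ‖γ t‖ ^ 2 + K * ‖(γ t).fst‖ ^ 2 := by
  obtain ⟨C, κ, P, hC, hκ, hP⟩ := exists_lieForm_le_of_observable (euclideanOp S) (euclideanOp T) l
    (fun u hu => hST.eq_zero u hu)
  obtain ⟨s, hs⟩ : ∃ s, s = ‖euclideanOp S‖ := ⟨_, rfl⟩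
  obtain ⟨s', hs'⟩ : ∃ s', s' = ‖euclideanOp Sᵀ‖ := ⟨_, rfl⟩
  obtain ⟨p, hp⟩ : ∃ p, p = ‖P‖ := ⟨_, rfl⟩
  obtain ⟨r, hr⟩ : ∃ r, r = ‖euclideanOp T‖ := ⟨_, rfl⟩
  have hs0 : 0 ≤ s := hs ▸ norm_nonneg _
  have hs0' : 0 ≤ s' := hs' ▸ norm_nonneg _
  have hp0 : 0 ≤ p := hp ▸ norm_nonneg _
  have hr0 : 0 ≤ r := hr ▸ norm_nonneg _
  have hS : ∀ z, ‖euclideanOp S z‖ ≤ s * ‖z‖ := fun z => hs ▸ (euclideanOp S).le_opNorm z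
  have hS' : ∀ x, ‖euclideanOp Sᵀ x‖ ≤ s' * ‖x‖ := fun z => hs' ▸ (euclideanOp Sᵀ).le_opNorm z
  have hPn : ∀ z, ‖P z‖ ≤ p * ‖z‖ := fun z => hp ▸ P.le_opNorm z
  have hTn : ∀ z, ‖euclideanOp T z‖ ≤ r * ‖z‖ := fun z => hr ▸ (euclideanOp T).le_opNorm z
  -- `a` collects the coefficients of all cross terms `‖x‖ * ‖z‖`. Young's inequality turns them
  -- into `κ / 2 * ‖z‖ ^ 2` and `a ^ 2 / (2 * κ) * ‖x‖ ^ 2`; the other parts of the final constant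
  -- come from `⟪x, S Sᵀ x⟫` and from completing `‖z‖ ^ 2` to `‖ξ‖ ^ 2`.
  obtain ⟨a, ha⟩ : ∃ a, a = 2 * (s' * p) + C * (θ * s) + C * (s * r) := ⟨_, rfl⟩
  have ha0 : 0 ≤ a := by rw [ha]; positivity
  refine ⟨fun ξ => inner ℝ ξ.snd (P ξ.snd) + C * inner ℝ ξ.fst (euclideanOp S ξ.snd),
    p + C * s, κ / 2, κ / 2 + a ^ 2 / (2 * κ) + C * (s * s'), by positivity, by positivity,
    by positivity, fun ξ => ?_, fun γ hγ t ht hφt => ?_⟩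
  · have hx := norm_nonneg ξ.fst
    have hz := norm_nonneg ξ.snd
    have h1 : |inner ℝ ξ.snd (P ξ.snd)| ≤ ‖ξ.snd‖ * (p * ‖ξ.snd‖) :=
      (abs_real_inner_le_norm _ _).trans (mul_le_mul_of_nonneg_left (hPn _) hz)
    have h2 : |inner ℝ ξ.fst (euclideanOp S ξ.snd)| ≤ ‖ξ.fst‖ * (s * ‖ξ.snd‖) :=
      (abs_real_inner_le_norm _ _).trans (mul_le_mul_of_nonneg_left (hS _) hx)
    have h3 := abs_add_le (inner ℝ ξ.snd (P ξ.snd)) (C * inner ℝ ξ.fst (euclideanOp S ξ.snd))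
    rw [abs_mul, abs_of_nonneg hC] at h3
    have h4 := mul_le_mul_of_nonneg_left h2 hC
    have h5 : ‖ξ.fst‖ * ‖ξ.snd‖ ≤ ‖ξ.fst‖ ^ 2 + ‖ξ.snd‖ ^ 2 := by
      nlinarith [sq_nonneg (‖ξ.fst‖ - ‖ξ.snd‖), sq_nonneg ‖ξ.fst‖, sq_nonneg ‖ξ.snd‖]
    have h6 := mul_le_mul_of_nonneg_left h5 (mul_nonneg hC hs0)
    have h7 : 0 ≤ p * ‖ξ.fst‖ ^ 2 := by positivity
    rw [norm_sq_state]
    linarith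
  · have hx' := hγ.hasDerivWithinAt_fst ht
    have hz' := hγ.hasDerivWithinAt_snd ht
    have hPz := P.hasFDerivAt.comp_hasDerivWithinAt t hz'
    have hSz := (euclideanOp S).hasFDerivAt.comp_hasDerivWithinAt t hz'
    refine ⟨_, (hz'.inner ℝ hPz).add ((hx'.inner ℝ hSz).const_mul C), ?_⟩
    have hx := norm_nonneg (γ t).fst
    have hz := norm_nonneg (γ t).snd
    rw [norm_sq_state]
    simp only [Function.comp_apply, vectorField_fst, vectorField_snd]
    generalize (γ t).fst = x at *
    generalize (γ t).snd = z at *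
    have e : inner ℝ z (P (euclideanOp Sᵀ x + euclideanOp T z))
          + inner ℝ (euclideanOp Sᵀ x + euclideanOp T z) (P z)
          + C * (inner ℝ x (euclideanOp S (euclideanOp Sᵀ x + euclideanOp T z))
            + inner ℝ (-φ x - euclideanOp S z) (euclideanOp S z))
        = lieForm (euclideanOp T) P z - C * ‖euclideanOp S z‖ ^ 2
          + (inner ℝ z (P (euclideanOp Sᵀ x)) + inner ℝ (euclideanOp Sᵀ x) (P z))
          + C * (inner ℝ x (euclideanOp S (euclideanOp Sᵀ x))
            + inner ℝ x (euclideanOp S (euclideanOp T z)) - inner ℝ (φ x) (euclideanOp S z)) := by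
      simp only [lieForm, map_add, inner_add_left, inner_add_right, inner_sub_left, inner_neg_left,
        real_inner_self_eq_norm_sq]
      ring
    have b1 : inner ℝ z (P (euclideanOp Sᵀ x)) ≤ ‖z‖ * (p * (s' * ‖x‖)) :=
      (real_inner_le_norm _ _).trans (mul_le_mul_of_nonneg_left
        ((hPn _).trans (mul_le_mul_of_nonneg_left (hS' x) hp0)) hz)
    have b2 : inner ℝ (euclideanOp Sᵀ x) (P z) ≤ (s' * ‖x‖) * (p * ‖z‖) :=
      (real_inner_le_norm _ _).trans (mul_le_mul (hS' x) (hPn z) (norm_nonneg _) (by positivity))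
    have b3 : inner ℝ x (euclideanOp S (euclideanOp Sᵀ x)) ≤ ‖x‖ * (s * (s' * ‖x‖)) :=
      (real_inner_le_norm _ _).trans (mul_le_mul_of_nonneg_left
        ((hS _).trans (mul_le_mul_of_nonneg_left (hS' x) hs0)) hx)
    have b4 : inner ℝ x (euclideanOp S (euclideanOp T z)) ≤ ‖x‖ * (s * (r * ‖z‖)) :=
      (real_inner_le_norm _ _).trans (mul_le_mul_of_nonneg_left
        ((hS _).trans (mul_le_mul_of_nonneg_left (hTn z) hs0)) hx)
    have b5 : -inner ℝ (φ x) (euclideanOp S z) ≤ (θ * ‖x‖) * (s * ‖z‖) :=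
      (neg_le_abs _).trans ((abs_real_inner_le_norm _ _).trans
        (mul_le_mul hφt (hS z) (norm_nonneg _) (by positivity)))
    have b6 := mul_le_mul_of_nonneg_left (add_le_add (add_le_add b3 b4) b5) hC
    have b7 : a * (‖x‖ * ‖z‖) ≤ κ / 2 * ‖z‖ ^ 2 + a ^ 2 / (2 * κ) * ‖x‖ ^ 2 := by
      have h1 : κ / 2 * ‖z‖ ^ 2 + a ^ 2 / (2 * κ) * ‖x‖ ^ 2 - a * (‖x‖ * ‖z‖)
          = (κ * ‖z‖ - a * ‖x‖) ^ 2 / (2 * κ) := by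
        field_simp
        ring
      have h2 : 0 ≤ (κ * ‖z‖ - a * ‖x‖) ^ 2 / (2 * κ) := by positivity
      linarith
    rw [e]
    have b8 : a * (‖x‖ * ‖z‖) = 2 * (s' * p) * (‖x‖ * ‖z‖) + C * (θ * s) * (‖x‖ * ‖z‖)
        + C * (s * r) * (‖x‖ * ‖z‖) := by
      rw [ha]
      ring
    linarith [hP z]

end System

/-! ### Stability, convergence and exponential decay. -/

section Stability

variable {n l : ℕ} {φ : EuclideanSpace ℝ (Fin n) → EuclideanSpace ℝ (Fin n)}
  {S : Matrix (Fin n) (Fin l) ℝ} {T : Matrix (Fin l) (Fin l) ℝ}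

lemma isStable_of_dissipative {E : Type*} [NormedAddCommGroup E] [InnerProductSpace ℝ E]
    [FiniteDimensional ℝ E] {F : E → E} (hF : ∀ ξ, inner ℝ ξ (F ξ) ≤ 0) (hF1 : ContDiff ℝ 1 F) :
    IsStable F := fun ε hε =>
  ⟨ε, hε, fun ξ₀ hξ₀ => ⟨exists_isForwardSolution_of_dissipative hF hF1 ξ₀,
    fun γ hγ hγ0 t ht => (hγ.norm_le hF ht).trans_lt (by rwa [hγ0])⟩⟩

/-- Along each solution the component `x` tends to zero. -/
lemma IsForwardSolution.eventually_norm_fst_lt (hφ : ContDiff ℝ 1 φ)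
    (hφ0 : ∀ x, 0 ≤ inner ℝ x (φ x)) (hφ_pos : ∀ x, x ≠ 0 → 0 < inner ℝ x (φ x))
    (hT : (-(T + Tᵀ)).PosSemidef) {γ : ℝ → State n l}
    (hγ : IsForwardSolution (vectorField φ S T) γ) {ε : ℝ} (hε : 0 < ε) :
    ∀ᶠ t in atTop, ‖(γ t).fst‖ < ε := by
  have hF : ∀ ξ, inner ℝ ξ (vectorField φ S T ξ) ≤ 0 := fun ξ =>
    (inner_vectorField_le hT ξ).trans (neg_nonpos.2 (hφ0 _))
  have hγR : ∀ t, 0 ≤ t → ‖γ t‖ ≤ ‖γ 0‖ := fun t ht => hγ.norm_le hF ht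
  obtain ⟨B, hB⟩ := (isCompact_closedBall (0 : State n l) ‖γ 0‖).exists_bound_of_continuousOn
    (contDiff_vectorField (S := S) (T := T) hφ).continuous.continuousOn
  have hB' : ∀ t, 0 ≤ t → ‖vectorField φ S T (γ t)‖ ≤ B := fun t ht =>
    hB _ (mem_closedBall_zero_iff.2 (hγR t ht))
  refine eventually_lt_of_dissipation (v := fun t => ‖γ t‖ ^ 2) (g := fun t => ‖(γ t).fst‖)
    (B := B) (fun t _ => by positivity) (fun t ht => hγ.hasDerivWithinAt_norm_sq ht)
    (fun t _ => by linarith [hF (γ t)]) ((norm_nonneg _).trans (hB' 0 le_rfl))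
    (fun s t hs hst => ?_) (fun δ hδ => ?_) hε
  -- The field is bounded on the ball that contains the trajectory, so `‖x‖` is Lipschitz in time.
  · have h1 := Convex.norm_image_sub_le_of_norm_hasDerivWithin_le
      (fun t ht => hγ t ht) (fun t ht => hB' t ht) (convex_Ici 0)
      (mem_Ici.2 (hs.trans hst)) (mem_Ici.2 hs)
    have h2 : ‖(γ s).fst - (γ t).fst‖ ≤ ‖γ s - γ t‖ := WithLp.norm_fst_le _ (γ s - γ t)
    have h3 := norm_sub_norm_le (γ s).fst (γ t).fst
    rw [Real.norm_eq_abs, abs_sub_comm, abs_of_nonneg (sub_nonneg.2 hst)] at h1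
    linarith
  -- On this compact shell `⟪x, φ x⟫` has a positive lower bound.
  · have hcomp : IsCompact (Metric.closedBall (0 : EuclideanSpace ℝ (Fin n)) ‖γ 0‖ ∩
        {x | δ ≤ ‖x‖}) :=
      (isCompact_closedBall _ _).inter_right (isClosed_le continuous_const continuous_norm)
    obtain ⟨m, hm, hmle⟩ := hcomp.exists_forall_le' (f := fun x => inner ℝ x (φ x)) (a := 0)
      (continuous_id.inner hφ.continuous).continuousOn
      (fun x hx => hφ_pos x (norm_pos_iff.1 (hδ.trans_le hx.2)))
    refine ⟨m, hm, fun t ht hδt => ?_⟩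
    have h1 := hmle (γ t).fst
      ⟨mem_closedBall_zero_iff.2 ((WithLp.norm_fst_le _ _).trans (hγR t ht)), hδt⟩
    have h2 := inner_vectorField_le (φ := φ) (S := S) hT (γ t)
    linarith

/-- Every solution tends to the origin. -/
lemma IsForwardSolution.tendsto_zero (hφ : ContDiff ℝ 1 φ) (hφ_zero : φ 0 = 0)
    (hφ_pos : ∀ x, x ≠ 0 → 0 < inner ℝ x (φ x))
    (hT : (-(T + Tᵀ)).PosSemidef) (hST : IsObservable S T) {γ : ℝ → State n l}
    (hγ : IsForwardSolution (vectorField φ S T) γ) : Tendsto γ atTop (𝓝 0) := by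
  have hφ0 : ∀ x, 0 ≤ inner ℝ x (φ x) := fun x => by
    rcases eq_or_ne x 0 with rfl | hx
    · simp
    · exact (hφ_pos x hx).le
  have hF : ∀ ξ, inner ℝ ξ (vectorField φ S T ξ) ≤ 0 := fun ξ =>
    (inner_vectorField_le hT ξ).trans (neg_nonpos.2 (hφ0 _))
  -- No global Lipschitz constant is needed: one on the ball containing the trajectory suffices.
  obtain ⟨θ, hθ⟩ := hφ.contDiffOn.exists_lipschitzOnWith one_ne_zero
    (convex_closedBall (0 : EuclideanSpace ℝ (Fin n)) ‖γ 0‖) (isCompact_closedBall _ _)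
  have hφγ : ∀ t, 0 ≤ t → ‖φ (γ t).fst‖ ≤ θ * ‖(γ t).fst‖ := fun t ht => by
    simpa [hφ_zero] using hθ.norm_sub_le
      (mem_closedBall_zero_iff.2 ((WithLp.norm_fst_le _ (γ t)).trans (hγ.norm_le hF ht)))
      (Metric.mem_closedBall_self (norm_nonneg (γ 0)))
  obtain ⟨Q, D, κ, K, hD, hκ, hK, hQ, hQd⟩ := hST.exists_correction (φ := φ) θ.coe_nonneg
  choose! d hd hdle using fun t ht => hQd γ hγ t ht (hφγ t ht)
  -- As `|Q ξ| ≤ D * ‖ξ‖ ^ 2`, the weight `D + 1` places this function between `‖ξ‖ ^ 2` and `(2 * D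
  -- + 1) * ‖ξ‖ ^ 2`.
  have hWd : ∀ t, 0 ≤ t → HasDerivWithinAt (fun t => (D + 1) * ‖γ t‖ ^ 2 + Q (γ t))
      ((D + 1) * (2 * inner ℝ (γ t) (vectorField φ S T (γ t))) + d t) (Ici 0) t := fun t ht =>
    ((hγ.hasDerivWithinAt_norm_sq ht).const_mul _).add (hd t ht)
  have hx : Tendsto (fun t => ‖(γ t).fst‖) atTop (𝓝 0) := by
    refine (nhds_basis_abs_sub_lt (0 : ℝ)).tendsto_right_iff.2 fun ε hε => ?_
    filter_upwards [hγ.eventually_norm_fst_lt hφ hφ0 hφ_pos hT hε] with t ht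
    simpa using ht
  have hx2 : Tendsto (fun t => K * ‖(γ t).fst‖ ^ 2) atTop (𝓝 0) := by
    simpa using (hx.pow 2).const_mul K
  have hc : 0 < κ / (2 * D + 1) := by positivity
  have hWle : ∀ t, 0 ≤ t →
      (D + 1) * (2 * inner ℝ (γ t) (vectorField φ S T (γ t))) + d t
        ≤ -(κ / (2 * D + 1)) * ((D + 1) * ‖γ t‖ ^ 2 + Q (γ t)) + K * ‖(γ t).fst‖ ^ 2 := by
    intro t ht
    have h1 := (abs_le.1 (hQ (γ t))).2
    have h2 : κ / (2 * D + 1) * ((D + 1) * ‖γ t‖ ^ 2 + Q (γ t)) ≤ κ * ‖γ t‖ ^ 2 := by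
      rw [div_mul_eq_mul_div, div_le_iff₀ (by positivity), mul_assoc]
      exact mul_le_mul_of_nonneg_left (by linarith) hκ.le
    have h3 : (D + 1) * (2 * inner ℝ (γ t) (vectorField φ S T (γ t))) ≤ 0 :=
      mul_nonpos_of_nonneg_of_nonpos (by positivity) (by linarith [hF (γ t)])
    linarith [hdle t ht]
  rw [tendsto_zero_iff_norm_tendsto_zero]
  refine (nhds_basis_abs_sub_lt (0 : ℝ)).tendsto_right_iff.2 fun ε hε => ?_
  filter_upwards [eventually_lt_of_deriv_le_add hc hWd hWle hx2 (pow_pos hε 2)] with t ht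
  have h1 := (abs_le.1 (hQ (γ t))).1
  have h2 : ‖γ t‖ ^ 2 < ε ^ 2 := by linarith
  have h3 := lt_of_pow_lt_pow_left₀ 2 hε.le h2
  simpa using h3

lemma isGloballyExponentiallyStable_vectorField (hφ : ContDiff ℝ 1 φ) (hφ_zero : φ 0 = 0)
    (hT : (-(T + Tᵀ)).PosSemidef) (hST : IsObservable S T) {θ w : ℝ} (hθ : 0 < θ) (hw : 0 < w)
    (hφθ : ∀ x y, ‖φ x - φ y‖ ≤ θ * ‖x - y‖)
    (hφw : ∀ x, w * inner ℝ x x ≤ inner ℝ x (φ x)) :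
    IsGloballyExponentiallyStable (vectorField φ S T) := by
  have hφw' : ∀ x, w * ‖x‖ ^ 2 ≤ inner ℝ x (φ x) := fun x => by
    simpa only [real_inner_self_eq_norm_sq] using hφw x
  have hF : ∀ ξ, inner ℝ ξ (vectorField φ S T ξ) ≤ -(w * ‖ξ.fst‖ ^ 2) := fun ξ =>
    (inner_vectorField_le hT ξ).trans (neg_le_neg (hφw' _))
  have hF0 : ∀ ξ, inner ℝ ξ (vectorField φ S T ξ) ≤ 0 := fun ξ =>
    (hF ξ).trans (neg_nonpos.2 (by positivity))
  have hφx : ∀ x, ‖φ x‖ ≤ θ * ‖x‖ := fun x => by simpa [hφ_zero] using hφθ x 0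
  obtain ⟨Q, D, κ, K, hD, hκ, hK, hQ, hQd⟩ := hST.exists_correction (φ := φ) hθ.le
  -- `D + 1` makes `M ‖ξ‖ ^ 2 + Q` dominate `‖ξ‖ ^ 2`; `K / (2 * w)` lets the dissipation `2 * w * M
  -- * ‖x‖ ^ 2` absorb `K * ‖x‖ ^ 2`.
  obtain ⟨M, hM⟩ : ∃ M, M = D + 1 + K / (2 * w) := ⟨_, rfl⟩
  have hMD : D + 1 ≤ M := by
    have : 0 ≤ K / (2 * w) := by positivity
    linarith
  have hMK : K ≤ M * (2 * w) := by
    have h1 : K / (2 * w) * (2 * w) = K := by field_simp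
    have h2 : 0 ≤ (D + 1) * (2 * w) := by positivity
    rw [hM, add_mul, h1]
    linarith
  have hMpos : 0 < M := by linarith
  have hMD0 : 0 < M + D := by linarith
  have hc : 0 < κ / (M + D) := by positivity
  -- The root and the halved rate arise because the estimate is proved for `‖γ t‖ ^ 2`.
  refine ⟨√(M + D), κ / (M + D) / 2, Real.sqrt_pos.2 hMD0, by positivity, fun ξ₀ =>
    ⟨exists_isForwardSolution_of_dissipative hF0 (contDiff_vectorField hφ) ξ₀,
      fun γ hγ hγ0 t ht => ?_⟩⟩
  choose! d hd hdle using fun t ht => hQd γ hγ t ht (hφx _)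
  have hWd : ∀ t, 0 ≤ t → HasDerivWithinAt (fun t => M * ‖γ t‖ ^ 2 + Q (γ t))
      (M * (2 * inner ℝ (γ t) (vectorField φ S T (γ t))) + d t) (Ici 0) t := fun t ht =>
    ((hγ.hasDerivWithinAt_norm_sq ht).const_mul _).add (hd t ht)
  have hdecay := le_add_exp_of_deriv_le (c := κ / (M + D)) (ε := 0) le_rfl hWd (fun t ht => by
    have h1 := (abs_le.1 (hQ (γ t))).2
    have h2 : κ / (M + D) * (M * ‖γ t‖ ^ 2 + Q (γ t)) ≤ κ * ‖γ t‖ ^ 2 := by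
      rw [div_mul_eq_mul_div, div_le_iff₀ (by positivity), mul_assoc]
      exact mul_le_mul_of_nonneg_left (by linarith) hκ.le
    have h3 := mul_le_mul_of_nonneg_left (hF (γ t)) hMpos.le
    have h4 := mul_le_mul_of_nonneg_right hMK (sq_nonneg ‖(γ t).fst‖)
    linarith [hdle t ht]) ht
  simp only [zero_add, sub_zero] at hdecay
  have h0 : M * ‖γ 0‖ ^ 2 + Q (γ 0) ≤ (M + D) * ‖ξ₀‖ ^ 2 := by
    have := (abs_le.1 (hQ (γ 0))).2
    rw [hγ0] at this ⊢
    linarith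
  have h1 : ‖γ t‖ ^ 2 ≤ M * ‖γ t‖ ^ 2 + Q (γ t) := by
    have h2 := (abs_le.1 (hQ (γ t))).1
    have h3 := mul_le_mul_of_nonneg_right hMD (sq_nonneg ‖γ t‖)
    linarith
  refine (pow_le_pow_iff_left₀ (norm_nonneg _) (by positivity) two_ne_zero).1 ?_
  have hexp : Real.exp (-(κ / (M + D) / 2) * t) ^ 2 = Real.exp (-(κ / (M + D)) * t) := by
    rw [← Real.exp_nat_mul]
    congr 1
    push_cast
    ring
  rw [mul_pow, mul_pow, Real.sq_sqrt hMD0.le, hexp]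
  exact h1.trans (hdecay.trans (mul_le_mul_of_nonneg_right h0 (Real.exp_pos _).le))

end Stability

end SaddleFlow

theorem mainTheorem8 (n l : ℕ)
    (φ : EuclideanSpace ℝ (Fin n) → EuclideanSpace ℝ (Fin n))
    (S : Matrix (Fin n) (Fin l) ℝ) (T : Matrix (Fin l) (Fin l) ℝ)
    (hφ_smooth : ContDiff ℝ ∞ φ) (hφ_zero : φ 0 = 0)
    (hφ_pos : ∀ x : EuclideanSpace ℝ (Fin n), x ≠ 0 → 0 < inner ℝ x (φ x))
    (hT : (-(T + Tᵀ)).PosSemidef)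
    (hST : SaddleFlow.IsObservable S T) :
    SaddleFlow.IsAsymptoticallyStable (SaddleFlow.vectorField φ S T) ∧
    ∀ θ w : ℝ, 0 < θ → 0 < w →
      (∀ x y : EuclideanSpace ℝ (Fin n), ‖φ x - φ y‖ ≤ θ * ‖x - y‖) →
      (∀ x : EuclideanSpace ℝ (Fin n), w * inner ℝ x x ≤ inner ℝ x (φ x)) →
      SaddleFlow.IsGloballyExponentiallyStable (SaddleFlow.vectorField φ S T) := by
  have hφ1 : ContDiff ℝ 1 φ := hφ_smooth.of_le (by exact_mod_cast le_top)
  -- The radius `1` is arbitrary: every solution converges to the origin.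
  refine ⟨⟨SaddleFlow.isStable_of_dissipative (fun ξ => ?_)
    (SaddleFlow.contDiff_vectorField hφ1), 1, one_pos, fun γ hγ _ =>
      hγ.tendsto_zero hφ1 hφ_zero hφ_pos hT hST⟩, fun θ w hθ hw hφθ hφw =>
      SaddleFlow.isGloballyExponentiallyStable_vectorField hφ1 hφ_zero hT hST hθ hw hφθ hφw⟩
  refine (SaddleFlow.inner_vectorField_le hT ξ).trans (neg_nonpos.2 ?_)
  rcases eq_or_ne ξ.fst 0 with hx | hx
  · rw [hx, inner_zero_left]
  · exact (hφ_pos _ hx).le
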